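/- Let $A$ be a unital $C^*$-algebra and $P\subset A$ a $C^*$-subalgebra containing the unit of $A$. Put $A^\infty=\ell^\infty(\mathbb N,A)/c_0(A)$, regard $A$ as the subalgebra of classes of constant sequences, put $A_\infty=A^\infty\cap A'$, and regard $P^\infty=\ell^\infty(\mathbb N,P)/c_0(P)$ as a subalgebra of $A^\infty$. A conditional expectation $E\colon A\to P$ (a positive contractive linear $P$-bimodule map with $E|_P=\mathrm{id}_P$) has finite index if it has a quasi-basis, that is, a finite family $(u_i,v_i)_{i=1}^n$ in $A\times A$ with $$a=\sum_{i=1}^n u_iE(v_ia)=\sum_{i=1}^n E(au_i)v_i\qquad\text{for all }a\in A;$$ then $\operatorname{Index}E=\sum_{i=1}^n u_iv_i$, which is an invertible central element of $A$ independent of the quasi-basis. Let $E^\infty\colon A^\infty\to P^\infty$ be the map induced by applying $E$ termwise. The inclusion $P\subset A$ has the Rohlin property if there are a conditional expectation $E$ from $A$ onto $P$ of finite index and a projection $e\in A_\infty$ such that $E^\infty(e)=(\operatorname{Index}E)^{-1}$ and the map $A\ni x\mapsto xe$ is injective. **Theorem.** Suppose that the inclusion $P\subset A$ has the Rohlin property.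 If $A$ has topological stable rank one, i.e. the invertible elements of $A$ are dense in $A$, then $P$ has topological stable rank one, i.e. the invertible elements of $P$ are dense in $P$. -/

import Mathlib

open Filter Topology BoundedContinuousFunction

noncomputable section

/-! ### The sequence algebra `l^∞(ℕ, A) / c₀(A)` -/

section SequenceAlgebra

variable (A : Type*) [NormedRing A]

/-- The ideal `c₀(A)` of null sequences in `l^∞(ℕ, A)`. Bounded sequences are the bounded
functions on the discrete space `ℕ`, with pointwise operations. -/
def nullSeq : Ideal (ℕ →ᵇ A) where
  carrier := {f | Tendsto (fun n => ‖f n‖) atTop (𝓝 0)}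
  zero_mem' := by simp
  add_mem' := by
    intro f g hf hg
    have h := hf.add hg
    rw [add_zero] at h
    exact squeeze_zero (fun n => norm_nonneg _) (fun n => norm_add_le (f n) (g n)) h
  smul_mem' := by
    intro c f hf
    have h := hf.const_mul ‖c‖
    rw [mul_zero] at h
    refine squeeze_zero (fun n => norm_nonneg _) (fun n => ?_) h
    exact (norm_mul_le (c n) (f n)).trans
      (mul_le_mul_of_nonneg_right (c.norm_coe_le_norm n) (norm_nonneg _))

theorem mem_nullSeq {A : Type*} [NormedRing A] {f : ℕ →ᵇ A} :
    f ∈ nullSeq A ↔ Tendsto (fun n => ‖f n‖) atTop (𝓝 0) := Iff.rfl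

instance nullSeq_isTwoSided : (nullSeq A).IsTwoSided where
  mul_mem_of_left := by
    intro f c hf
    rw [mem_nullSeq] at hf ⊢
    have h := hf.mul_const ‖c‖
    rw [zero_mul] at h
    refine squeeze_zero (fun n => norm_nonneg _) (fun n => ?_) h
    exact (norm_mul_le (f n) (c n)).trans
      (mul_le_mul_of_nonneg_left (c.norm_coe_le_norm n) (norm_nonneg _))

/-- `A^∞ = l^∞(ℕ, A) / c₀(A)`. -/
abbrev SeqAlg : Type _ := (ℕ →ᵇ A) ⧸ nullSeq A

variable {A}

/-- The class in `A^∞` of a bounded sequence. -/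
def SeqAlg.mk : (ℕ →ᵇ A) →+* SeqAlg A := Ideal.Quotient.mk (nullSeq A)

/-- The image of `a : A` in `A^∞`: the class of the constant sequence. -/
def SeqAlg.const (a : A) : SeqAlg A := SeqAlg.mk (BoundedContinuousFunction.const ℕ a)

theorem SeqAlg.mk_eq_mk {f g : ℕ →ᵇ A} :
    SeqAlg.mk f = SeqAlg.mk g ↔ Tendsto (fun n => ‖f n - g n‖) atTop (𝓝 0) := by
  unfold SeqAlg.mk
  rw [Ideal.Quotient.eq, mem_nullSeq]
  rfl

/-- The termwise involution of `A^∞`. -/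
instance SeqAlg.instStar [StarRing A] [NormedStarGroup A] : Star (SeqAlg A) where
  star := Quotient.lift (fun f : ℕ →ᵇ A => SeqAlg.mk (star f)) (by
    intro f g h
    have h1 : SeqAlg.mk f = SeqAlg.mk g := Quotient.sound h
    rw [SeqAlg.mk_eq_mk] at h1
    refine SeqAlg.mk_eq_mk.2 (h1.congr fun n => ?_)
    rw [BoundedContinuousFunction.star_apply, BoundedContinuousFunction.star_apply,
      ← star_sub, norm_star])

theorem SeqAlg.star_mk [StarRing A] [NormedStarGroup A] (f : ℕ →ᵇ A) :
    star (SeqAlg.mk f) = SeqAlg.mk (star f) := rfl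

/-- The map `A^∞ → B^∞` obtained by applying a bounded linear map `A → B` termwise. -/
def SeqAlg.map {B : Type*} [NormedRing B] [NormedAlgebra ℂ A] [NormedAlgebra ℂ B]
    (T : A →L[ℂ] B) : SeqAlg A → SeqAlg B :=
  Quotient.lift (fun f : ℕ →ᵇ A => SeqAlg.mk (T.compLeftContinuousBounded ℕ f)) (by
    intro f g h
    have h1 : SeqAlg.mk f = SeqAlg.mk g := Quotient.sound h
    rw [SeqAlg.mk_eq_mk] at h1
    have h2 := h1.const_mul ‖T‖
    rw [mul_zero] at h2
    refine SeqAlg.mk_eq_mk.2 (squeeze_zero (fun n => norm_nonneg _) (fun n => ?_) h2)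
    have h3 := T.le_opNorm (f n - g n)
    rw [map_sub] at h3
    exact h3)

theorem SeqAlg.map_mk {B : Type*} [NormedRing B] [NormedAlgebra ℂ A] [NormedAlgebra ℂ B]
    (T : A →L[ℂ] B) (f : ℕ →ᵇ A) :
    SeqAlg.map T (SeqAlg.mk f) = SeqAlg.mk (T.compLeftContinuousBounded ℕ f) := rfl

end SequenceAlgebra

/-! ### Conditional expectations of finite Watatani index -/

section Index

variable {A : Type*} [CStarAlgebra A]

/-- A conditional expectation from `A` onto the unital subalgebra `P`: a positive contractive
linear `P`-bimodule map `A → P` that fixes `P` pointwise. -/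
structure CondExpectation (P : StarSubalgebra ℂ A) where
  toLinearMap : A →ₗ[ℂ] P
  map_coe : ∀ p : P, toLinearMap (p : A) = p
  map_mul_left : ∀ (p : P) (a : A), toLinearMap ((p : A) * a) = p * toLinearMap a
  map_mul_right : ∀ (a : A) (p : P), toLinearMap (a * (p : A)) = toLinearMap a * p
  map_nonneg : ∀ a : A, ∃ b : P, toLinearMap (star a * a) = star b * b
  norm_map_le : ∀ a : A, ‖toLinearMap a‖ ≤ ‖a‖

namespace CondExpectation

variable {P : StarSubalgebra ℂ A}

instance : CoeFun (CondExpectation P) (fun _ => A → P) := ⟨fun E => E.toLinearMap⟩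

/-- The family `(u i, v i)` is a quasi-basis for `E`. -/
def IsQuasiBasis (E : CondExpectation P) {n : ℕ} (u v : Fin n → A) : Prop :=
  ∀ a : A, a = ∑ i, u i * (E (v i * a) : A) ∧ a = ∑ i, (E (a * u i) : A) * v i

/-- `d` is the value `∑ uᵢ vᵢ` for some quasi-basis of `E`. -/
def IsIndex (E : CondExpectation P) (d : A) : Prop :=
  ∃ (n : ℕ) (u v : Fin n → A), E.IsQuasiBasis u v ∧ d = ∑ i, u i * v i

/-- `Index E < ∞`: there is a quasi-basis. -/
def FiniteIndex (E : CondExpectation P) : Prop :=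
  ∃ (n : ℕ) (u v : Fin n → A), E.IsQuasiBasis u v

open Classical in
/-- The Watatani index `∑ uᵢ vᵢ` of `E`, meaningful when `E` has finite index. It does not depend
on the quasi-basis, see `CondExpectation.index_eq`. -/
def index (E : CondExpectation P) : A := if h : ∃ d, E.IsIndex d then h.choose else 0

theorem IsIndex.unique {E : CondExpectation P} {c d : A} (hc : E.IsIndex c) (hd : E.IsIndex d) :
    c = d := by
  obtain ⟨n, u, v, huv, rfl⟩ := hc
  obtain ⟨m, x, y, hxy, rfl⟩ := hd
  calc ∑ i, u i * v i = ∑ i, u i * ∑ j, (E (v i * x j) : A) * y j :=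
        Finset.sum_congr rfl fun i _ => by rw [← (hxy (v i)).2]
    _ = ∑ i, ∑ j, u i * (E (v i * x j) : A) * y j := by simp only [Finset.mul_sum, mul_assoc]
    _ = ∑ j, ∑ i, u i * (E (v i * x j) : A) * y j := Finset.sum_comm
    _ = ∑ j, (∑ i, u i * (E (v i * x j) : A)) * y j := by simp only [Finset.sum_mul]
    _ = ∑ j, x j * y j := Finset.sum_congr rfl fun j _ => by rw [← (huv (x j)).1]

theorem index_eq {E : CondExpectation P} {n : ℕ} {u v : Fin n → A} (h : E.IsQuasiBasis u v) :
    E.index = ∑ i, u i * v i := by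
  have hex : ∃ d, E.IsIndex d := ⟨_, n, u, v, h, rfl⟩
  unfold index
  rw [dif_pos hex]
  exact hex.choose_spec.unique ⟨n, u, v, h, rfl⟩

/-- `E` as a bounded linear map. -/
def toCLM (E : CondExpectation P) : A →L[ℂ] P :=
  E.toLinearMap.mkContinuous 1 fun a => by simpa using E.norm_map_le a

/-- `E^∞ : A^∞ → P^∞`, the termwise application of `E`. -/
def seqMap (E : CondExpectation P) : SeqAlg A → SeqAlg P := SeqAlg.map E.toCLM

end CondExpectation

/-- The inclusion map `P → A` as a bounded linear map. -/
def StarSubalgebra.inclCLM (P : StarSubalgebra ℂ A) : P →L[ℂ] A :=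
  (P.subtype : P →ₗ[ℂ] A).mkContinuous 1 fun p => by simp

/-- The inclusion `P^∞ ⊆ A^∞`. -/
def StarSubalgebra.seqIncl (P : StarSubalgebra ℂ A) : SeqAlg P → SeqAlg A :=
  SeqAlg.map P.inclCLM

/-- `e` is a Rohlin projection for `E`: a projection of `A_∞ = A^∞ ∩ A'` such that
`E^∞(e) = (Index E)⁻¹` in `A^∞` and `A ∋ x ↦ x e` is injective. (The index of a conditional
expectation of finite index is invertible, so `Ring.inverse` is its inverse.) -/
def IsRohlinProjection {P : StarSubalgebra ℂ A} (E : CondExpectation P) (e : SeqAlg A) : Prop :=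
  IsStarProjection e ∧
  (∀ a : A, Commute e (SeqAlg.const a)) ∧
  P.seqIncl (E.seqMap e) = SeqAlg.const (Ring.inverse E.index) ∧
  Function.Injective (fun x : A => SeqAlg.const x * e)

/-- The inclusion `P ⊆ A` has the Rohlin property: there is a conditional expectation from `A`
onto `P` of finite index that admits a Rohlin projection. -/
def HasRohlinProperty (P : StarSubalgebra ℂ A) : Prop :=
  ∃ E : CondExpectation P, E.FiniteIndex ∧ ∃ e : SeqAlg A, IsRohlinProjection E e

end Index

/-- `tsr(A) = 1`: the invertible elements of the unital algebra `A` are dense. -/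
def HasStableRankOne (A : Type*) [NormedRing A] : Prop := Dense {a : A | IsUnit a}

end

noncomputable section

/-! Write d for the index of E and put β(x) = d E^∞(e x), a linear map from A to P^∞. It fixes P
because d E^∞(e) = 1, and it turns out to be multiplicative. Given p in P, take an invertible a in A
near p: β(a) is invertible with inverse β(a⁻¹) and is near β(p) = p, so a late term of a
representing sequence of β(a) is an invertible element of P near p.

Multiplicativity rests on e x = e β(x) (`IsRohlinProjection.mul_eq`): since e commutes with A, it
gives e x y = e β(x) β(y), and applying d E^∞ removes e. To prove it, the defect T(x) = e x - d e
E^∞(e x) is expanded in a quasi-basis. The sum of the T(vⱼ*) T(uⱼ)* vanishes by direct computation;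
positivity of the Gram matrix E(vᵢ vⱼ*) rewrites it as a sum of terms s s*, so every s is zero, and
then so is T. -/

/-! ### Positivity of matrices over a C*-algebra. -/

theorem CStarAlgebra.exists_conjugate_eq_neg {C : Type*} [CStarAlgebra C] {x : C}
    (hx : star x = x) : ∃ y m : C, star y = y ∧ y * x * y = -(star m * m) ∧
      (m = 0 → ∃ b, x = star b * b) := by
  let _ : PartialOrder C := CStarAlgebra.spectralOrder C
  have _ : StarOrderedRing C := CStarAlgebra.spectralOrderedRing C
  have hsa : IsSelfAdjoint x := hx
  have hy0 : 0 ≤ x⁻ := CFC.negPart_nonneg x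
  have hys : star x⁻ = x⁻ := (IsSelfAdjoint.of_nonneg hy0).star_eq
  -- With y = x⁻, orthogonality of x⁺ and x⁻ gives y x y = -y³, and y³ = 0 forces y = 0, i.e. x ≥ 0.
  have h3 : 0 ≤ x⁻ * x⁻ * x⁻ := by
    have := star_left_conjugate_nonneg hy0 x⁻
    rwa [hys] at this
  obtain ⟨m, hm⟩ := CStarAlgebra.nonneg_iff_eq_star_mul_self.1 h3
  refine ⟨x⁻, m, hys, ?_, fun h => ?_⟩
  · have h4 : x⁻ * (x⁺ - x⁻) * x⁻ = -(star m * m) := by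
      rw [mul_sub, CFC.negPart_mul_posPart, zero_sub, neg_mul, hm]
    rwa [CFC.posPart_sub_negPart x hsa] at h4
  · rw [← CStarAlgebra.nonneg_iff_eq_star_mul_self,
      CStarAlgebra.nonneg_iff_isSelfAdjoint_and_negPart_eq_zero]
    rw [h, mul_zero] at hm
    generalize x⁻ = y at *
    have h2 : y * y = 0 := by
      refine (CStarRing.star_mul_self_eq_zero_iff (y * y)).1 ?_
      rw [star_mul, hys, ← mul_assoc, hm, zero_mul]
    refine ⟨hsa, (CStarRing.star_mul_self_eq_zero_iff y).1 ?_⟩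
    rw [hys, h2]

/-- A matrix over a `C*`-algebra that is nonnegative as a quadratic form is of the form
`star m * m`. -/
theorem CStarMatrix.exists_eq_star_mul_self {B : Type*} [CStarAlgebra B] [PartialOrder B]
    [StarOrderedRing B] {ι : Type*} [Fintype ι] [DecidableEq ι] (M : CStarMatrix ι ι B)
    (hM : star M = M) (hpos : ∀ p : ι → B, 0 ≤ ∑ i, ∑ j, p i * M i j * star (p j)) :
    ∃ m : CStarMatrix ι ι B, M = star m * m := by
  obtain ⟨y, m, hys, hyM, hm⟩ := CStarAlgebra.exists_conjugate_eq_neg hM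
  apply hm
  -- The quadratic form evaluated on row i of y is the (i, i) entry of y M y = -m* m. Zero diagonal
  -- of m* m forces m = 0.
  have hdiag : ∀ i, (star m * m) i i ≤ 0 := by
    intro i
    have h1 := hpos (fun k => y i k)
    have h2 : (y * M * y) i i = ∑ k, ∑ l, y i k * M k l * star (y i l) := by
      rw [CStarMatrix.mul_apply, Finset.sum_comm]
      refine Finset.sum_congr rfl fun l _ => ?_
      rw [CStarMatrix.mul_apply, Finset.sum_mul]
      refine Finset.sum_congr rfl fun k _ => ?_
      rw [← CStarMatrix.star_apply, hys]
    rw [← h2, hyM] at h1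
    exact neg_nonneg.1 h1
  ext k i
  have h1 := hdiag i
  rw [CStarMatrix.mul_apply] at h1
  simp only [CStarMatrix.star_apply] at h1
  have h2 := (Finset.sum_eq_zero_iff_of_nonneg (fun k _ => star_mul_self_nonneg (m k i))).1
    (le_antisymm h1 (Finset.sum_nonneg fun k _ => star_mul_self_nonneg (m k i)))
  exact (CStarRing.star_mul_self_eq_zero_iff _).1 (h2 k (Finset.mem_univ k))

/-! ### The algebraic core: vanishing of the defect T. -/

/-- A projection `e` with `d * F e = 1`, where `d = ∑ uᵢ vᵢ` is the index of the conditional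
expectation `F`, satisfies `e x = d e F (e x)`. -/
theorem proj_mul_eq_of_index_mul_eq_one {R : Type*} [Ring R] [StarRing R] {n : ℕ} (F : R →+ R)
    (hFr : ∀ x y, F (x * F y) = F x * F y)
    (hFs : ∀ x, F (star x) = star (F x)) (u v : Fin n → R)
    (h1 : ∀ a, ∑ i, u i * F (v i * a) = a) (h2 : ∀ a, ∑ i, F (a * u i) * v i = a)
    {d e : R} (hd : ∀ x, d * x = x * d) (hds : star d = d) (hduv : ∑ i, u i * v i = d)
    (he : e * e = e) (hes : star e = e) (hde : d * F e = 1) (m : Fin n → Fin n → R)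
    (hm : ∀ i j, F (v i * star (v j)) = ∑ k, star (m k i) * m k j)
    (hpos : ∀ s : Fin n → R, ∑ k, s k * star (s k) = 0 → ∀ k, s k = 0) (x : R) :
    e * x = d * e * F (e * x) := by
  let T : R →+ R := AddMonoidHom.mulLeft e -
    (AddMonoidHom.mulLeft (d * e)).comp (F.comp (AddMonoidHom.mulLeft e))
  have hT : ∀ x, T x = e * x - d * e * F (e * x) := fun x => rfl
  have hTF : ∀ x y, T (x * F y) = T x * F y := by
    intro x y
    rw [hT, hT, sub_mul, ← mul_assoc e, hFr, mul_assoc (d * e)]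
  have g1 : ∑ j, star (v j) * star (u j) = d := by
    rw [← hds, ← hduv, star_sum]; simp only [star_mul]
  have g2 : ∀ a, ∑ j, star (v j) * F (star (u j) * a) = a := by
    intro a
    have := congrArg star (h2 (star a))
    simpa only [star_sum, star_mul, ← hFs, star_star] using this
  have g3 : ∀ a, ∑ j, F (a * star (v j)) * star (u j) = a := by
    intro a
    have := congrArg star (h1 (star a))
    simpa only [star_sum, star_mul, ← hFs, star_star] using this
  have hTs : ∀ y, star (T y) = star y * e - F (star y * e) * (e * d) := by
    intro y
    rw [hT, star_sub, star_mul, hes, star_mul, star_mul, hes, hds, ← hFs, star_mul, hes]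
  -- Expanding gives four sums; the quasi-basis identities and d F(e) = 1 reduce each to ± e d, with
  -- signs +, -, -, +.
  have key : ∑ j, T (star (v j)) * star (T (u j)) = 0 := by
    have hexp : ∀ j, T (star (v j)) * star (T (u j)) =
        e * (star (v j) * star (u j)) * e - e * (star (v j) * F (star (u j) * e)) * (e * d)
        - d * e * (F (e * star (v j)) * star (u j)) * e
        + d * e * F (e * (star (v j) * F (star (u j) * e))) * (e * d) := by
      intro j
      rw [hT, hTs, ← mul_assoc e (star (v j)) (F _), hFr]
      noncomm_ring
    simp only [hexp, Finset.sum_add_distrib, Finset.sum_sub_distrib, ← Finset.sum_mul,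
      ← Finset.mul_sum, ← map_sum, g1, g2, g3, he]
    have h4 : d * e * F e * (e * d) = e * d := by
      rw [hd e, mul_assoc e, hde, mul_one, ← mul_assoc, he]
    rw [h4, ← mul_assoc e e d, he, mul_assoc (d * e), he, mul_assoc d, he, hd, mul_assoc e, hd e,
      ← mul_assoc, he]
    abel
  -- Expand vⱼ* in the quasi-basis and use that T is right linear over the range of F; the inner sum
  -- is sₖ, and `key` becomes ∑ sₖ sₖ* = 0.
  have hs : ∀ j, T (star (v j)) = ∑ k, (∑ i, T (u i) * star (m k i)) * m k j := by
    intro j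
    conv_lhs => rw [← h1 (star (v j)), map_sum]
    simp only [hTF]
    simp only [hm, Finset.mul_sum, Finset.sum_mul, mul_assoc]
    exact Finset.sum_comm
  have hz : ∀ k, ∑ i, T (u i) * star (m k i) = 0 := by
    apply hpos
    rw [← key]
    simp only [hs, star_sum, star_mul, star_star, Finset.mul_sum, Finset.sum_mul, mul_assoc]
    exact Finset.sum_comm
  have hT0 : T x = 0 := by
    rw [← g2 x, map_sum]
    refine Finset.sum_eq_zero fun j _ => ?_
    rw [hTF, hs]
    simp [hz]
  rwa [hT, sub_eq_zero] at hT0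

/-! ### The star ring A^∞ and termwise maps. -/

namespace SeqAlg

section

variable {A : Type*} [NormedRing A]

theorem mk_surjective : Function.Surjective (SeqAlg.mk : (ℕ →ᵇ A) → SeqAlg A) :=
  Ideal.Quotient.mk_surjective

/-- The embedding of `A` into `A^∞` as a ring homomorphism. -/
def constHom : A →+* SeqAlg A where
  toFun := SeqAlg.const
  map_one' := map_one (SeqAlg.mk (A := A))
  map_mul' a b := map_mul (SeqAlg.mk (A := A)) (.const ℕ a) (.const ℕ b)
  map_zero' := map_zero (SeqAlg.mk (A := A))
  map_add' a b := map_add (SeqAlg.mk (A := A)) (.const ℕ a) (.const ℕ b)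

theorem constHom_apply (a : A) : constHom a = SeqAlg.mk (BoundedContinuousFunction.const ℕ a) := rfl

/-- The termwise involution makes `A^∞` a star ring. -/
instance instStarRing [StarRing A] [NormedStarGroup A] : StarRing (SeqAlg A) where
  star := star
  star_involutive x := by
    obtain ⟨f, rfl⟩ := mk_surjective x
    rw [star_mk, star_mk, star_star]
  star_mul x y := by
    obtain ⟨f, rfl⟩ := mk_surjective x
    obtain ⟨g, rfl⟩ := mk_surjective y
    rw [← map_mul, star_mk, star_mk, star_mk, ← map_mul]
    exact congrArg SeqAlg.mk (BoundedContinuousFunction.ext fun n => star_mul (f n) (g n))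
  star_add x y := by
    obtain ⟨f, rfl⟩ := mk_surjective x
    obtain ⟨g, rfl⟩ := mk_surjective y
    rw [← map_add, star_mk, star_mk, star_mk, ← map_add]
    exact congrArg SeqAlg.mk (BoundedContinuousFunction.ext fun n => star_add (f n) (g n))

theorem constHom_star [StarRing A] [NormedStarGroup A] (a : A) :
    constHom (star a) = star (constHom a) := rfl

/-- Termwise application of a bounded linear map, as an additive map. -/
def mapHom [NormedAlgebra ℂ A] (T : A →L[ℂ] A) : SeqAlg A →+ SeqAlg A where
  toFun := SeqAlg.map T
  map_zero' := by
    rw [← map_zero (SeqAlg.mk (A := A)), map_mk]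
    exact congrArg SeqAlg.mk (BoundedContinuousFunction.ext fun n => map_zero T)
  map_add' x y := by
    obtain ⟨f, rfl⟩ := mk_surjective x
    obtain ⟨g, rfl⟩ := mk_surjective y
    rw [← map_add, map_mk, map_mk, map_mk, ← map_add]
    exact congrArg SeqAlg.mk (BoundedContinuousFunction.ext fun n => map_add T (f n) (g n))

theorem mapHom_mk [NormedAlgebra ℂ A] (T : A →L[ℂ] A) (f : ℕ →ᵇ A) :
    mapHom T (SeqAlg.mk f) = SeqAlg.mk (T.compLeftContinuousBounded ℕ f) := rfl

theorem mapHom_const [NormedAlgebra ℂ A] (T : A →L[ℂ] A) (a : A) :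
    mapHom T (constHom a) = constHom (T a) := rfl

end

variable {A : Type*} [CStarAlgebra A]

/-- Termwise, each positive summand is dominated in norm by the whole sum, which is a null sequence.
-/
theorem eq_zero_of_sum_mul_star_eq_zero {n : ℕ} (s : Fin n → SeqAlg A)
    (h : ∑ k, s k * star (s k) = 0) (k : Fin n) : s k = 0 := by
  let _ : PartialOrder A := CStarAlgebra.spectralOrder A
  have _ : StarOrderedRing A := CStarAlgebra.spectralOrderedRing A
  choose f hf using fun k => mk_surjective (s k)
  obtain rfl : (fun k => SeqAlg.mk (f k)) = s := funext hf
  simp only [star_mk, ← map_mul, ← map_sum] at h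
  rw [← map_zero (SeqAlg.mk (A := A)), mk_eq_mk] at h
  simp only
  rw [← map_zero (SeqAlg.mk (A := A)), mk_eq_mk]
  have h2 : Tendsto (fun n => ‖f k n‖ * ‖f k n‖) atTop (𝓝 0) := by
    refine squeeze_zero (fun n => by positivity) (fun n => ?_) h
    rw [← CStarRing.norm_self_mul_star]
    refine CStarAlgebra.norm_le_norm_of_nonneg_of_le (mul_star_self_nonneg _) ?_
    have e1 : (∑ k, f k * star (f k)) n - (0 : ℕ →ᵇ A) n = ∑ k, f k n * star (f k n) := by
      simp
    rw [e1]
    exact Finset.single_le_sum (f := fun k => f k n * star (f k n))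
      (fun i _ => mul_star_self_nonneg _) (Finset.mem_univ k)
  have h3 := h2.sqrt
  simpa using h3

end SeqAlg

/-! ### Conditional expectations, quasi-bases and faithfulness of E^∞. -/

namespace CondExpectation

variable {A : Type*} [CStarAlgebra A] {P : StarSubalgebra ℂ A} (E : CondExpectation P)

/-- Polarization: E(a* a) is self-adjoint, and a = 1 + x shows that E(x + x*) is too; the same for
ix separates the two terms. -/
theorem map_star (x : A) : E (star x) = star (E x) := by
  have hs : ∀ a, star (E (star a * a)) = E (star a * a) := by
    intro a
    obtain ⟨b, hb⟩ := E.map_nonneg a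
    rw [hb, star_mul, star_star]
  have h1 : ∀ x, star (E x) + star (E (star x)) = E x + E (star x) := by
    intro x
    have e1 : star (1 + x) * (1 + x) = star 1 * 1 + (x + star x) + star x * x := by
      simp only [star_add, star_one]; noncomm_ring
    have h := hs (1 + x)
    rw [e1, map_add, map_add, star_add, star_add, hs, hs] at h
    have h' := add_left_cancel (add_right_cancel h)
    rwa [map_add, star_add] at h'
  have h2 := h1 (Complex.I • x)
  simp only [star_smul, map_smul, Complex.star_def, Complex.conj_I, neg_smul, map_neg, star_neg,
    neg_neg] at h2
  have h3 : -star (E x) + star (E (star x)) = E x - E (star x) := by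
    have := congrArg (fun y => (-Complex.I) • y) h2
    simpa [smul_smul, sub_eq_add_neg] using this
  have h4 := h1 x
  have h5 : (2 : ℂ) • E (star x) = (2 : ℂ) • star (E x) := by
    rw [two_smul, two_smul]
    have : E (star x) + E (star x) = (E x + E (star x)) - (E x - E (star x)) := by abel
    rw [this, ← h4, ← h3]; abel
  have := congrArg (fun y => (2⁻¹ : ℂ) • y) h5
  simpa [smul_smul] using this

/-- The conditional expectation as a bounded operator on `A`. -/
def toEnd : A →L[ℂ] A := P.inclCLM.comp E.toCLM

theorem toEnd_apply (a : A) : E.toEnd a = (E a : A) := rfl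

theorem toEnd_mul_toEnd (a b : A) : E.toEnd (a * E.toEnd b) = E.toEnd a * E.toEnd b :=
  congrArg Subtype.val (E.map_mul_right a (E b))

theorem toEnd_coe_mul (p : P) (b : A) : E.toEnd (p * b) = p * E.toEnd b :=
  congrArg Subtype.val (E.map_mul_left p b)

theorem toEnd_coe (p : P) : E.toEnd p = p := congrArg Subtype.val (E.map_coe p)

theorem toEnd_star (a : A) : E.toEnd (star a) = star (E.toEnd a) :=
  congrArg Subtype.val (E.map_star a)

theorem seqIncl_seqMap (x : SeqAlg A) : P.seqIncl (E.seqMap x) = SeqAlg.mapHom E.toEnd x := by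
  obtain ⟨f, rfl⟩ := SeqAlg.mk_surjective x
  rfl

theorem mapHom_toEnd_mul (x y : SeqAlg A) : SeqAlg.mapHom E.toEnd (x * SeqAlg.mapHom E.toEnd y) =
    SeqAlg.mapHom E.toEnd x * SeqAlg.mapHom E.toEnd y := by
  obtain ⟨f, rfl⟩ := SeqAlg.mk_surjective x
  obtain ⟨g, rfl⟩ := SeqAlg.mk_surjective y
  simp only [SeqAlg.mapHom_mk, ← map_mul]
  exact congrArg SeqAlg.mk (BoundedContinuousFunction.ext fun n => E.toEnd_mul_toEnd (f n) (g n))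

theorem mapHom_toEnd_star (x : SeqAlg A) :
    SeqAlg.mapHom E.toEnd (star x) = star (SeqAlg.mapHom E.toEnd x) := by
  obtain ⟨f, rfl⟩ := SeqAlg.mk_surjective x
  simp only [SeqAlg.mapHom_mk, SeqAlg.star_mk]
  exact congrArg SeqAlg.mk (BoundedContinuousFunction.ext fun n => E.toEnd_star (f n))

variable {E}

theorem IsQuasiBasis.sum_mul_mapHom {n : ℕ} {u v : Fin n → A} (h : E.IsQuasiBasis u v)
    (x : SeqAlg A) :
    ∑ i, SeqAlg.constHom (u i) * SeqAlg.mapHom E.toEnd (SeqAlg.constHom (v i) * x) = x := by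
  obtain ⟨f, rfl⟩ := SeqAlg.mk_surjective x
  simp only [SeqAlg.constHom_apply, ← map_mul, SeqAlg.mapHom_mk, ← map_sum]
  refine congrArg SeqAlg.mk (BoundedContinuousFunction.ext fun n => ?_)
  rw [BoundedContinuousFunction.sum_apply]
  exact (h (f n)).1.symm

theorem IsQuasiBasis.sum_mapHom_mul {n : ℕ} {u v : Fin n → A} (h : E.IsQuasiBasis u v)
    (x : SeqAlg A) :
    ∑ i, SeqAlg.mapHom E.toEnd (x * SeqAlg.constHom (u i)) * SeqAlg.constHom (v i) = x := by
  obtain ⟨f, rfl⟩ := SeqAlg.mk_surjective x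
  simp only [SeqAlg.constHom_apply, ← map_mul, SeqAlg.mapHom_mk, ← map_sum]
  refine congrArg SeqAlg.mk (BoundedContinuousFunction.ext fun n => ?_)
  rw [BoundedContinuousFunction.sum_apply]
  exact (h (f n)).2.symm

theorem IsQuasiBasis.star {n : ℕ} {u v : Fin n → A} (h : E.IsQuasiBasis u v) :
    E.IsQuasiBasis (fun i => star (v i)) (fun i => star (u i)) := by
  have hE : ∀ a, (E (Star.star a) : A) = Star.star (E a : A) := E.toEnd_star
  intro a
  constructor
  · have := congrArg Star.star (h (Star.star a)).2
    simpa only [star_sum, star_mul, ← hE, star_star] using this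
  · have := congrArg Star.star (h (Star.star a)).1
    simpa only [star_sum, star_mul, ← hE, star_star] using this

theorem IsQuasiBasis.star_index {n : ℕ} {u v : Fin n → A} (h : E.IsQuasiBasis u v) :
    Star.star E.index = E.index := by
  conv_rhs => rw [index_eq h.star]
  rw [index_eq h, star_sum]
  simp only [star_mul]

/-- Expand vᵢ a by the second quasi-basis identity, exchange the sums, and recombine a uⱼ by the
first. -/
theorem IsQuasiBasis.index_mul_comm {n : ℕ} {u v : Fin n → A} (h : E.IsQuasiBasis u v) (a : A) :
    E.index * a = a * E.index := by
  rw [index_eq h, Finset.sum_mul, Finset.mul_sum]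
  calc ∑ i, u i * v i * a = ∑ i, u i * ∑ j, (E (v i * a * u j) : A) * v j :=
        Finset.sum_congr rfl fun i _ => by rw [← (h (v i * a)).2, mul_assoc]
    _ = ∑ i, ∑ j, u i * (E (v i * (a * u j)) : A) * v j := by simp only [Finset.mul_sum, mul_assoc]
    _ = ∑ j, ∑ i, u i * (E (v i * (a * u j)) : A) * v j := Finset.sum_comm
    _ = ∑ j, (∑ i, u i * (E (v i * (a * u j)) : A)) * v j := by simp only [Finset.sum_mul]
    _ = ∑ j, a * (u j * v j) := Finset.sum_congr rfl fun j _ => by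
        rw [← (h (a * u j)).1, mul_assoc]

/-- The Gram matrix `E (vᵢ vⱼ*)` is of the form `m* m` with a matrix `m` over `P`. -/
theorem exists_gram_eq (E : CondExpectation P) (hP : IsClosed (P : Set A)) {n : ℕ}
    (v : Fin n → A) :
    ∃ m : Fin n → Fin n → P, ∀ i j, E (v i * star (v j)) = ∑ k, star (m k i) * m k j := by
  have : IsClosed (P : Set A) := hP
  let _ : CStarAlgebra P := StarSubalgebra.cstarAlgebra P
  let _ : PartialOrder P := CStarAlgebra.spectralOrder P
  have _ : StarOrderedRing P := CStarAlgebra.spectralOrderedRing P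
  obtain ⟨m, hm⟩ := CStarMatrix.exists_eq_star_mul_self (B := P)
    (CStarMatrix.ofMatrix (Matrix.of fun i j => E (v i * star (v j)))) (by
      ext i j : 2
      rw [CStarMatrix.star_apply]
      simp only [CStarMatrix.ofMatrix_apply, Matrix.of_apply]
      rw [← E.map_star, star_mul, star_star]) (by
      intro p
      -- By the bimodule property the quadratic form at p is E(w w*) with w = ∑ pᵢ vᵢ.
      obtain ⟨b, hb⟩ := E.map_nonneg (star (∑ i, (p i : A) * v i))
      have : ∑ i, ∑ j, p i * E (v i * star (v j)) * star (p j) = star b * b := by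
        rw [← hb, star_star, star_sum, Finset.sum_mul, map_sum]
        refine Finset.sum_congr rfl fun i _ => ?_
        rw [Finset.mul_sum, map_sum]
        refine Finset.sum_congr rfl fun j _ => ?_
        rw [star_mul, ← StarMemClass.coe_star, mul_assoc (p i : A), ← mul_assoc (v i),
          E.map_mul_left, E.map_mul_right, mul_assoc]
      simp only [CStarMatrix.ofMatrix_apply, Matrix.of_apply]
      rw [this]
      exact star_mul_self_nonneg b)
  refine ⟨fun k i => m k i, fun i j => ?_⟩
  have h := congrFun (congrFun hm i) j
  rw [CStarMatrix.mul_apply] at h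
  simpa only [CStarMatrix.star_apply, CStarMatrix.ofMatrix_apply, Matrix.of_apply] using h

/-- The Kadison inequality for a conditional expectation. -/
theorem norm_map_sq_le (E : CondExpectation P) (hP : IsClosed (P : Set A)) (a : A) :
    ‖E a‖ * ‖E a‖ ≤ ‖E (star a * a)‖ := by
  have : IsClosed (P : Set A) := hP
  let _ : CStarAlgebra P := StarSubalgebra.cstarAlgebra P
  let _ : PartialOrder P := CStarAlgebra.spectralOrder P
  have _ : StarOrderedRing P := CStarAlgebra.spectralOrderedRing P
  -- The variance E((a - E a)* (a - E a)) equals E(a* a) - E(a)* E(a).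
  obtain ⟨b, hb⟩ := E.map_nonneg (a - E a)
  have h1 : E (star (a - E a) * (a - E a)) = E (star a * a) - star (E a) * E a := by
    have : star (a - (E a : A)) * (a - E a) = star a * a - star a * (E a : A)
        - ((star (E a) : P) : A) * a + ((star (E a) * E a : P) : A) := by
      rw [star_sub, ← StarMemClass.coe_star, MulMemClass.coe_mul]
      noncomm_ring
    rw [this, map_add, map_sub, map_sub, E.map_mul_right, E.map_mul_left, E.map_coe, E.map_star]
    abel
  rw [h1, sub_eq_iff_eq_add] at hb
  rw [← CStarRing.norm_star_mul_self, hb]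
  refine CStarAlgebra.norm_le_norm_of_nonneg_of_le (star_mul_self_nonneg _) ?_
  exact le_add_of_nonneg_left (star_mul_self_nonneg b)

/-- Writing ‖v‖² - v* v = c* c, the difference ‖v‖² E(a* a) - E((v a)* (v a)) is E((c a)* (c a)) ≥
0. -/
theorem norm_map_star_mul_le (E : CondExpectation P) (hP : IsClosed (P : Set A)) (v a : A) :
    ‖E (star (v * a) * (v * a))‖ ≤ ‖v‖ ^ 2 * ‖E (star a * a)‖ := by
  have : IsClosed (P : Set A) := hP
  let _ : CStarAlgebra P := StarSubalgebra.cstarAlgebra P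
  let _ : PartialOrder P := CStarAlgebra.spectralOrder P
  have _ : StarOrderedRing P := CStarAlgebra.spectralOrderedRing P
  obtain ⟨c, hc⟩ : ∃ c, algebraMap ℝ A (‖v‖ ^ 2) - star v * v = star c * c := by
    let _ : PartialOrder A := CStarAlgebra.spectralOrder A
    have _ : StarOrderedRing A := CStarAlgebra.spectralOrderedRing A
    exact CStarAlgebra.nonneg_iff_eq_star_mul_self.1
      (sub_nonneg.2 CStarAlgebra.star_mul_le_algebraMap_norm_sq)
  obtain ⟨b, hb⟩ := E.map_nonneg (c * a)
  obtain ⟨b', hb'⟩ := E.map_nonneg (v * a)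
  have h2 : star (c * a) * (c * a) =
      ((‖v‖ ^ 2 : ℝ) : ℂ) • (star a * a) - star (v * a) * (v * a) := by
    have : star (c * a) * (c * a) = star a * (star c * c) * a := by
      rw [star_mul]; simp only [mul_assoc]
    rw [this, ← hc, mul_sub, sub_mul, star_mul, Complex.coe_smul, Algebra.algebraMap_eq_smul_one]
    simp only [mul_assoc, mul_smul_comm, smul_mul_assoc, one_mul]
  rw [h2, map_sub, map_smul, sub_eq_iff_eq_add] at hb
  have h3 : ‖((‖v‖ ^ 2 : ℝ) : ℂ) • E (star a * a)‖ = ‖v‖ ^ 2 * ‖E (star a * a)‖ := by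
    rw [norm_smul, Complex.norm_real, Real.norm_of_nonneg (by positivity)]
  rw [← h3, hb]
  refine CStarAlgebra.norm_le_norm_of_nonneg_of_le (hb' ▸ star_mul_self_nonneg b') ?_
  exact le_add_of_nonneg_left (star_mul_self_nonneg b)

/-- The termwise extension of a conditional expectation of finite index is faithful on
projections. -/
theorem IsQuasiBasis.eq_zero_of_mapHom_eq_zero {n : ℕ} {u v : Fin n → A}
    (h : E.IsQuasiBasis u v) (hP : IsClosed (P : Set A)) {x : SeqAlg A}
    (hx : SeqAlg.mapHom E.toEnd (Star.star x * x) = 0) : x = 0 := by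
  rw [← h.sum_mul_mapHom x]
  refine Finset.sum_eq_zero fun i _ => ?_
  obtain ⟨f, rfl⟩ := SeqAlg.mk_surjective x
  rw [SeqAlg.star_mk, ← map_mul, SeqAlg.mapHom_mk, ← map_zero (SeqAlg.mk (A := A)),
    SeqAlg.mk_eq_mk] at hx
  -- These are the coefficients of x in the quasi-basis; Kadison's inequality bounds ‖E(vᵢ a)‖² by
  -- ‖vᵢ‖² ‖E(a* a)‖.
  have h0 : SeqAlg.mapHom E.toEnd (SeqAlg.constHom (v i) * SeqAlg.mk f) = 0 := by
    rw [SeqAlg.constHom_apply, ← map_mul, SeqAlg.mapHom_mk, ← map_zero (SeqAlg.mk (A := A)),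
      SeqAlg.mk_eq_mk]
    have h2 : Tendsto (fun n => ‖E.toEnd (v i * f n)‖ * ‖E.toEnd (v i * f n)‖) atTop (𝓝 0) := by
      have h3 := hx.const_mul (‖v i‖ ^ 2)
      rw [mul_zero] at h3
      refine squeeze_zero (fun n => by positivity) (fun n => ?_) h3
      refine ((E.norm_map_sq_le hP (v i * f n)).trans
        (E.norm_map_star_mul_le hP (v i) (f n))).trans_eq ?_
      simp [toEnd_apply]
    simpa using h2.sqrt
  rw [h0, mul_zero]

end CondExpectation

/-! ### Consequences of a Rohlin projection: the homomorphism β. -/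

namespace IsRohlinProjection

variable {A : Type*} [CStarAlgebra A] {P : StarSubalgebra ℂ A} {E : CondExpectation P}
  {e : SeqAlg A}

theorem mapHom_eq (he : IsRohlinProjection E e) :
    SeqAlg.mapHom E.toEnd e = SeqAlg.constHom (Ring.inverse E.index) :=
  (E.seqIncl_seqMap e).symm.trans he.2.2.1

/-- If d were not a unit, `Ring.inverse` would return 0, so E^∞(e) = 0 and e = 0 by faithfulness;
injectivity of x ↦ x e then makes A trivial, where d is a unit. -/
theorem isUnit_index (he : IsRohlinProjection E e) (hE : E.FiniteIndex)
    (hP : IsClosed (P : Set A)) : IsUnit E.index := by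
  obtain ⟨n, u, v, h⟩ := hE
  by_contra hu
  have h0 : e = 0 := by
    refine h.eq_zero_of_mapHom_eq_zero hP ?_
    rw [he.1.isSelfAdjoint.star_eq, he.1.isIdempotentElem.eq, he.mapHom_eq,
      Ring.inverse_non_unit _ hu, map_zero]
  have hs : Subsingleton A := ⟨fun a b => he.2.2.2 (by simp [h0])⟩
  exact hu (isUnit_of_subsingleton _)

theorem index_mul_mapHom (he : IsRohlinProjection E e) (hE : E.FiniteIndex)
    (hP : IsClosed (P : Set A)) :
    SeqAlg.constHom E.index * SeqAlg.mapHom E.toEnd e = 1 := by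
  rw [he.mapHom_eq, ← map_mul, Ring.mul_inverse_cancel _ (he.isUnit_index hE hP), map_one]

/-- The constant d⁻¹ is the limit of the terms E(fₙ) in the closed set P. Then 1 = E(d d⁻¹) = E(d)
d⁻¹, so d = E(d). -/
theorem index_mem (he : IsRohlinProjection E e) (hE : E.FiniteIndex)
    (hP : IsClosed (P : Set A)) : E.index ∈ P := by
  have hu := he.isUnit_index hE hP
  obtain ⟨f, rfl⟩ := SeqAlg.mk_surjective e
  have hmem : Ring.inverse E.index ∈ P := by
    have h1 := he.mapHom_eq
    rw [SeqAlg.mapHom_mk, SeqAlg.constHom_apply, SeqAlg.mk_eq_mk] at h1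
    have h2 := tendsto_iff_norm_sub_tendsto_zero.2 h1
    exact hP.mem_of_tendsto h2 (Eventually.of_forall fun n => (E (f n)).2)
  have h3 := congrArg Subtype.val (E.map_mul_right E.index ⟨_, hmem⟩)
  have h4 : (E 1 : A) = 1 := E.toEnd_coe 1
  simp only [Ring.mul_inverse_cancel _ hu, h4, MulMemClass.coe_mul] at h3
  have h5 : E.index = (E E.index : A) := by
    calc E.index = (E E.index : A) * Ring.inverse E.index * E.index := by rw [← h3, one_mul]
      _ = E E.index := by rw [mul_assoc, Ring.inverse_mul_cancel _ hu, mul_one]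
  rw [h5]
  exact (E E.index).2

theorem mapHom_index_mul (he : IsRohlinProjection E e) (hE : E.FiniteIndex)
    (hP : IsClosed (P : Set A)) (x : SeqAlg A) :
    SeqAlg.mapHom E.toEnd (SeqAlg.constHom E.index * x) =
      SeqAlg.constHom E.index * SeqAlg.mapHom E.toEnd x := by
  obtain ⟨f, rfl⟩ := SeqAlg.mk_surjective x
  simp only [SeqAlg.constHom_apply, ← map_mul, SeqAlg.mapHom_mk]
  exact congrArg SeqAlg.mk (BoundedContinuousFunction.ext fun n =>
    E.toEnd_coe_mul ⟨E.index, he.index_mem hE hP⟩ (f n))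

theorem constHom_index_mul_comm (hE : E.FiniteIndex) (x : SeqAlg A) :
    SeqAlg.constHom E.index * x = x * SeqAlg.constHom E.index := by
  obtain ⟨n, u, v, h⟩ := hE
  obtain ⟨f, rfl⟩ := SeqAlg.mk_surjective x
  simp only [SeqAlg.constHom_apply, ← map_mul]
  exact congrArg SeqAlg.mk (BoundedContinuousFunction.ext fun n => h.index_mul_comm (f n))

/-- The algebraic core applied to E^∞ on A^∞, with the quasi-basis and the Gram factor m embedded as
constant sequences. -/
theorem mul_eq (he : IsRohlinProjection E e) (hE : E.FiniteIndex)
    (hP : IsClosed (P : Set A)) (x : SeqAlg A) :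
    e * x = e * SeqAlg.mapHom E.toEnd (SeqAlg.constHom E.index * (e * x)) := by
  rw [he.mapHom_index_mul hE hP, ← mul_assoc, ← constHom_index_mul_comm hE]
  have hE' := hE
  obtain ⟨n, u, v, h⟩ := hE
  obtain ⟨m, hm⟩ := E.exists_gram_eq hP v
  refine proj_mul_eq_of_index_mul_eq_one (SeqAlg.mapHom E.toEnd) E.mapHom_toEnd_mul
    E.mapHom_toEnd_star _ _ h.sum_mul_mapHom h.sum_mapHom_mul (constHom_index_mul_comm hE')
    (by rw [← SeqAlg.constHom_star, h.star_index])
    (by rw [CondExpectation.index_eq h, map_sum]; simp only [map_mul])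
    he.1.isIdempotentElem.eq he.1.isSelfAdjoint.star_eq
    (he.index_mul_mapHom hE' hP) (fun i j => SeqAlg.constHom (m i j)) (fun i j => ?_)
    SeqAlg.eq_zero_of_sum_mul_star_eq_zero x
  simp only [← SeqAlg.constHom_star, ← map_mul, SeqAlg.mapHom_const, ← map_sum]
  rw [E.toEnd_apply, hm]
  simp

/-- The map `x ↦ (Index E) E^∞(e x)` is multiplicative on `A`. -/
theorem mapHom_mul_mapHom (he : IsRohlinProjection E e) (hE : E.FiniteIndex)
    (hP : IsClosed (P : Set A)) (x y : A) :
    SeqAlg.mapHom E.toEnd (SeqAlg.constHom E.index * (e * SeqAlg.constHom x)) *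
      SeqAlg.mapHom E.toEnd (SeqAlg.constHom E.index * (e * SeqAlg.constHom y)) =
    SeqAlg.mapHom E.toEnd (SeqAlg.constHom E.index * (e * SeqAlg.constHom (x * y))) := by
  have hx := he.mul_eq hE hP (SeqAlg.constHom x)
  have hy := he.mul_eq hE hP (SeqAlg.constHom y)
  have hc : e * SeqAlg.constHom x = SeqAlg.constHom x * e := he.2.1 x
  have h1 : e * SeqAlg.constHom (x * y) = e *
      SeqAlg.mapHom E.toEnd (SeqAlg.constHom E.index * (e * SeqAlg.constHom x)) *
      SeqAlg.mapHom E.toEnd (SeqAlg.constHom E.index * (e * SeqAlg.constHom y)) := by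
    rw [← hx, hc, mul_assoc, ← hy, map_mul, ← mul_assoc, hc, mul_assoc]
  rw [h1]
  generalize SeqAlg.constHom E.index * (e * SeqAlg.constHom x) = X
  generalize SeqAlg.constHom E.index * (e * SeqAlg.constHom y) = Y
  -- Both factors lie in the range of E^∞, so they pull out and leave d E^∞(e) = 1.
  rw [← mul_assoc, E.mapHom_toEnd_mul, ← mul_assoc, E.mapHom_toEnd_mul,
    he.mapHom_index_mul hE hP e, he.index_mul_mapHom hE hP, one_mul]

/-- On `P` the map `x ↦ (Index E) E^∞(e x)` is the identity. -/
theorem mapHom_coe (he : IsRohlinProjection E e) (hE : E.FiniteIndex)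
    (hP : IsClosed (P : Set A)) (p : P) :
    SeqAlg.mapHom E.toEnd (SeqAlg.constHom E.index * (e * SeqAlg.constHom (p : A))) =
      SeqAlg.constHom (p : A) := by
  conv_lhs => rw [← E.toEnd_coe p, ← SeqAlg.mapHom_const]
  rw [← mul_assoc, E.mapHom_toEnd_mul, he.mapHom_index_mul hE hP,
    he.index_mul_mapHom hE hP, one_mul, SeqAlg.mapHom_const, E.toEnd_coe]

end IsRohlinProjection

/-! ### Descent from P^∞ to P. -/

/-- An element with approximate left and right inverses is invertible. -/
theorem isUnit_of_norm_mul_sub_one_lt {B : Type*} [NormedRing B] [HasSummableGeomSeries B]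
    {y z : B} (h1 : ‖y * z - 1‖ < 1) (h2 : ‖z * y - 1‖ < 1) : IsUnit y := by
  have h3 : IsUnit (y * z) := by
    have := isUnit_one_sub_of_norm_lt_one (x := 1 - y * z) (by rwa [norm_sub_rev])
    simpa using this
  have h4 : IsUnit (z * y) := by
    have := isUnit_one_sub_of_norm_lt_one (x := 1 - z * y) (by rwa [norm_sub_rev])
    simpa using this
  obtain ⟨r, hr⟩ := h3.exists_right_inv
  obtain ⟨l, hl⟩ := h4.exists_left_inv
  rw [mul_assoc] at hr
  rw [← mul_assoc] at hl
  have : l * z = z * r := left_inv_eq_right_inv hl hr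
  exact ⟨⟨y, z * r, hr, by rw [← this, hl]⟩, rfl⟩

theorem mainTheorem4 {A : Type*} [CStarAlgebra A] (P : StarSubalgebra ℂ A)
    (hPclosed : IsClosed (P : Set A)) (hRohlin : HasRohlinProperty P)
    (hA : HasStableRankOne A) : HasStableRankOne P := by
  obtain ⟨E, hE, e, he⟩ := hRohlin
  have : IsClosed (P : Set A) := hPclosed
  have : CompleteSpace P := hPclosed.completeSpace_coe
  have hcoe := he.mapHom_coe hE hPclosed
  have hmul := he.mapHom_mul_mapHom hE hPclosed
  obtain ⟨f, rfl⟩ := SeqAlg.mk_surjective e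
  set d := E.index
  have hβ : ∀ x, SeqAlg.mapHom E.toEnd (SeqAlg.constHom d * (SeqAlg.mk f * SeqAlg.constHom x)) =
      SeqAlg.mk (E.toEnd.compLeftContinuousBounded ℕ (BoundedContinuousFunction.const ℕ d *
        (f * BoundedContinuousFunction.const ℕ x))) := fun x => rfl
  simp only [hβ, ← map_mul] at hmul
  simp only [SeqAlg.constHom_apply] at hcoe
  have hone : ∀ x y : A, x * y = 1 → Tendsto (fun n =>
      ‖E (d * (f n * x)) * E (d * (f n * y)) - 1‖) atTop (𝓝 0) := by
    intro x y hxy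
    have h1 := hmul x y
    rw [hxy] at h1
    exact SeqAlg.mk_eq_mk.1 (h1.trans (hcoe 1))
  intro p
  rw [Metric.mem_closure_iff]
  intro ε hε
  -- A Lipschitz constant, uniform in n, for x ↦ E(d fₙ x); the 1 keeps it positive for the
  -- division.
  set C := ‖d‖ * ‖f‖ + 1
  have hC : 0 < C := by positivity
  obtain ⟨a, ⟨a, rfl⟩, ha⟩ := Metric.mem_closure_iff.1 (hA (p : A)) (ε / 2 / C) (by positivity)
  have hp : Tendsto (fun n => ‖E (d * (f n * p)) - p‖) atTop (𝓝 0) :=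
    SeqAlg.mk_eq_mk.1 (hcoe p)
  -- At this n the term of β(a⁻¹) is an approximate two-sided inverse of that of β(a), and the term
  -- of β(p) is within ε/2 of p.
  obtain ⟨n, h1, h2, h3⟩ := (((hone a ↑a⁻¹ a.mul_inv).eventually_lt_const one_pos).and
    (((hone ↑a⁻¹ a a.inv_mul).eventually_lt_const one_pos).and
      (hp.eventually_lt_const (half_pos hε)))).exists
  refine ⟨E (d * (f n * a)), isUnit_of_norm_mul_sub_one_lt h1 h2, ?_⟩
  have h4 : ‖E (d * (f n * p)) - E (d * (f n * a))‖ ≤ ε / 2 := by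
    rw [← map_sub, ← mul_sub, ← mul_sub]
    calc ‖E (d * (f n * (p - a)))‖ ≤ ‖d * (f n * (p - a))‖ := E.norm_map_le _
      _ ≤ ‖d‖ * (‖f‖ * ‖(p : A) - a‖) := (norm_mul_le _ _).trans (by
          gcongr
          exact (norm_mul_le _ _).trans (by gcongr; exact f.norm_coe_le_norm n))
      _ ≤ C * (ε / 2 / C) := by
          rw [← mul_assoc]
          have : ‖(p : A) - a‖ ≤ ε / 2 / C := by rw [← dist_eq_norm]; exact ha.le
          gcongr
          exact le_add_of_nonneg_right zero_le_one
      _ = ε / 2 := by field_simp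
  calc dist p (E (d * (f n * a))) ≤ dist p (E (d * (f n * p))) +
        dist (E (d * (f n * p))) (E (d * (f n * a))) := dist_triangle _ _ _
    _ < ε / 2 + ε / 2 := by
        rw [dist_comm p, dist_eq_norm, dist_eq_norm]
        exact add_lt_add_of_lt_of_le h3 h4
    _ = ε := add_halves ε

end
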